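/- Let $c\ge 0$ and let $2\le N_1\le N_2\le\dots\le N_c\le 30$ be integers. Consider a random table with $c$ columns, column $i$ having $N_i$ possible values, which is uniformly distributed with density $p\in[0,1]$: each of the $N_1N_2\cdots N_c$ possible tuples is a row of the table with probability $p$, independently of the others. For a permutation $\sigma$ of $\{1,\dots,c\}$, let $R_\sigma$ be the expected total number of column runs (a run being a maximal block of consecutive equal entries in a column, and the runs of all $c$ columns being added up) after the columns are put in the order $\sigma(1),\dots,\sigma(c)$ and the rows are then sorted lexicographically. Then the increasing-cardinality column order minimizes the expected number of runs up to an additive term of at most $c$: for every permutation $\sigma$, $$R_{\mathrm{id}}\le R_\sigma+c.$$ -/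

import Mathlib

open MeasureTheory ProbabilityTheory

/-- A possible tuple (row) of a table whose `k`-th column takes the `N k` values
`0, 1, …, N k - 1`. -/
abbrev Row {c : ℕ} (N : Fin c → ℕ) : Type := (k : Fin c) → Fin (N k)

/-- A table (a set of distinct rows) with its columns rearranged: the `k`-th column of the
new table is the column `σ k` of the old one. -/
def reorderColumns {c : ℕ} {N : Fin c → ℕ} (σ : Equiv.Perm (Fin c)) (T : Finset (Row N)) :
    Finset (Row (fun k => N (σ k))) :=
  T.image (fun t k => t (σ k))

/-- The rows of a table, listed in increasing lexicographic order
(column `0` is compared first, then column `1`, and so on). -/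
noncomputable def lexSort {c : ℕ} {N : Fin c → ℕ} (T : Finset (Row N)) : List (Row N) :=
  ((T.map toLex.toEmbedding).sort (· ≤ ·)).map ofLex

/-- The number of runs (maximal blocks of consecutive equal entries) of a list. -/
def numRuns {α : Type*} [DecidableEq α] : List α → ℕ
  | [] => 0
  | [_] => 1
  | a :: b :: l => (if a = b then 0 else 1) + numRuns (b :: l)

/-- The total number of runs, over all columns, of a list of rows. -/
def runCount {c : ℕ} {N : Fin c → ℕ} (l : List (Row N)) : ℕ :=
  ∑ k : Fin c, numRuns (l.map (fun t => t k))

/-- The random table `T` is uniformly distributed with density `p`: the possible rows are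
present independently of one another, each with probability `p`. -/
structure IsUniformlyDistributed {c : ℕ} {N : Fin c → ℕ} {Ω : Type*} [MeasurableSpace Ω]
    (P : Measure Ω) (p : ℝ) (T : Ω → Finset (Row N)) : Prop where
  measurableSet_mem : ∀ t : Row N, MeasurableSet {ω | t ∈ T ω}
  indep : iIndepSet (fun t : Row N => {ω | t ∈ T ω}) P
  prob_mem : ∀ t : Row N, P.real {ω | t ∈ T ω} = p

/-- The expected total number of column runs when the columns of the random table `T` are put
in the order `σ 0, σ 1, …` and its rows are then sorted lexicographically. -/
noncomputable def expectedRuns {c : ℕ} {N : Fin c → ℕ} {Ω : Type*} [MeasurableSpace Ω]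
    (P : Measure Ω) (T : Ω → Finset (Row N)) (σ : Equiv.Perm (Fin c)) : ℝ :=
  ∫ ω, (runCount (lexSort (reorderColumns σ (T ω))) : ℝ) ∂P

/-!
Fix a column order, let `q = 1 - p`, and look at a column of cardinality `n`, writing `M` for the
product of the cardinalities before it and `ρ` for the product of those after it. The rows in
lexicographic order are the integers `0, …, M n ρ - 1`, and the entry of the row `i` in that column
is the digit `i / ρ % n`. The number of runs is the number of rows minus the number of pairs of
consecutive rows with the same digit, and a pair `i < j` is consecutive in the table with
probability `p² q ^ (j - i - 1)`. Summing these over all pairs with equal digits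
(`sum_equal_digit`) gives the expected number of runs (`expectedColumnRuns`) as a function of `M`,
`n` and `x = q ^ ρ`; it lies between `M * columnCost n x` and `M * columnCost n x + 1`
(`expectedColumnRuns_bounds`). This is where the additive term `c` comes from, and it remains to see
that the increasing order minimizes the sum of the main terms exactly.

Those main terms obey the recursion `orderCost`, so by insertion sort it is enough to compare the
two orders of a pair of adjacent columns of cardinalities `a ≤ b` (`columnCost_swap`). With
`n = a b`, the claimed inequality is, up to a positive factor,
`∑ kinkWeight n a i * x ^ i ≤ ∑ kinkWeight n b i * x ^ i`, both sums over `0 < i < n`. Now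
`kinkWeight n a` is minus the second difference of an explicit function `potential n a` on
`{0, …, n}`. Two summations by parts turn the difference of the two sides into
`(1 - x)² ∑ (potential n a s - potential n b s) x ^ (s - 1)`, and `potential n b ≤ potential n a`
holds pointwise on `{0, …, n}` unless `(a, b)` is `(2, 3)` or `(3, 4)` (`potential_le`). In these
two cases the difference is a polynomial that is visibly nonnegative on `[0, 1]`.
-/

/-! ### The potential and its second difference -/

/-- The value `(k³ - k) / 6 = C(k + 1, 3)`, whose second difference at `k` is `k`. -/
noncomputable def tetra (k : ℕ) : ℝ := ((k : ℝ) ^ 3 - k) / 6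

/-- The function of period `a` which equals `s (a - s) / (2 a)` for `0 ≤ s ≤ a`. -/
noncomputable def periodicParabola (a s : ℕ) : ℝ := ((s % a : ℕ) : ℝ) * (a - (s % a : ℕ)) / (2 * a)

/-- A function on `{0, …, n}` that vanishes at both ends, is symmetric under `s ↦ n - s` when
`a ∣ n`, and has second difference `-kinkWeight n a`. The subtractions inside `tetra` are
truncated, so that these two terms are present only within distance `a` of the ends. -/
noncomputable def potential (n a s : ℕ) : ℝ :=
  s * (n - s) / (2 * a) + ((a : ℝ) ^ 2 - 1) / 6 - periodicParabola a s
    - tetra (a - s) / a - tetra (a - (n - s)) / a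

/-- The weight `[a ∣ s] + (a - s)₊ / a + (a - (n - s))₊ / a`. For `0 < s < n` and `2 * a ≤ n` it
is `1` minus the coefficient of `x ^ s` in
`x (1 - x ^ a) (1 - x ^ (n - a)) / (a (1 - x)²) - ∑_{0 < j < n / a} x ^ (j a)`. -/
noncomputable def kinkWeight (n a s : ℕ) : ℝ :=
  (if a ∣ s then 1 else 0) + ((a - s : ℕ) : ℝ) / a + ((a - (n - s) : ℕ) : ℝ) / a

theorem tetra_second_difference (a s : ℕ) :
    tetra (a - (s + 2)) - 2 * tetra (a - (s + 1)) + tetra (a - s) = ((a - (s + 1) : ℕ) : ℝ) := by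
  rcases Nat.lt_or_ge s a with h | h
  · obtain ⟨k, rfl⟩ := Nat.exists_eq_add_of_lt h
    rw [show s + k + 1 - (s + 2) = k - 1 by omega, show s + k + 1 - (s + 1) = k by omega,
      show s + k + 1 - s = k + 1 by omega]
    rcases k with _ | k
    · simp [tetra]
    · simp only [Nat.add_sub_cancel, tetra]
      push_cast
      ring
  · rw [show a - (s + 2) = 0 by omega, show a - (s + 1) = 0 by omega, show a - s = 0 by omega]
    simp [tetra]

theorem periodicParabola_second_difference {a : ℕ} (ha : 2 ≤ a) (s : ℕ) :
    periodicParabola a (s + 2) - 2 * periodicParabola a (s + 1) + periodicParabola a s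
      = (if a ∣ s + 1 then 1 else 0) - 1 / a := by
  have ha0 : (a : ℝ) ≠ 0 := by positivity
  have hlt : s % a < a := Nat.mod_lt _ (by omega)
  obtain ⟨r, hr⟩ : ∃ r, s % a = r := ⟨_, rfl⟩
  have h1 : (s + 1) % a = (r + 1) % a := by rw [Nat.add_mod, hr, Nat.add_mod r, ← hr]; simp
  have h2 : (s + 2) % a = (r + 2) % a := by rw [Nat.add_mod, hr, Nat.add_mod r, ← hr]; simp
  simp only [periodicParabola, Nat.dvd_iff_mod_eq_zero, h1, h2, hr]
  rw [hr] at hlt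
  rcases (by omega : r + 2 < a ∨ r + 2 = a ∨ r + 1 = a) with h | h | h
  · rw [Nat.mod_eq_of_lt h, Nat.mod_eq_of_lt (by omega : r + 1 < a), if_neg (by omega)]
    push_cast
    field_simp
    ring
  · rw [h, Nat.mod_self, Nat.mod_eq_of_lt (by omega : r + 1 < a), if_neg (by omega)]
    subst h
    push_cast at ha0 ⊢
    field_simp
    ring
  · rw [show r + 2 = a + 1 by omega, h, Nat.mod_self, Nat.add_mod_left,
      Nat.mod_eq_of_lt (by omega : 1 < a), if_pos rfl]
    subst h
    push_cast at ha0 ⊢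
    field_simp
    ring

theorem potential_second_difference {n a s : ℕ} (ha : 2 ≤ a) (hs : s + 2 ≤ n) :
    potential n a (s + 2) - 2 * potential n a (s + 1) + potential n a s
      = - kinkWeight n a (s + 1) := by
  have ha0 : (a : ℝ) ≠ 0 := by positivity
  have h1 := tetra_second_difference a s
  have h2 := periodicParabola_second_difference ha s
  have h3 := tetra_second_difference a (n - (s + 2))
  rw [show n - (s + 2) + 2 = n - s by omega, show n - (s + 2) + 1 = n - (s + 1) by omega] at h3
  simp only [potential, kinkWeight]
  rw [eq_sub_iff_add_eq] at h2
  rw [← h1, ← h3, ← h2]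
  push_cast
  field_simp
  ring

theorem potential_zero {n a : ℕ} (ha : 2 ≤ a) (hn : a ≤ n) : potential n a 0 = 0 := by
  have ha0 : (a : ℝ) ≠ 0 := by positivity
  simp only [potential, periodicParabola, tetra, Nat.zero_mod, Nat.sub_zero,
    Nat.sub_eq_zero_of_le hn]
  push_cast
  field_simp
  ring

theorem periodicParabola_symm {n a s : ℕ} (ha : 2 ≤ a) (hn : a ∣ n) (hs : s ≤ n) :
    periodicParabola a (n - s) = periodicParabola a s := by
  have hlt : s % a < a := Nat.mod_lt _ (by omega)
  have h : (n - s) % a = if s % a = 0 then 0 else a - s % a := by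
    have key : ((n - s) % a + s % a) % a = 0 := by
      rw [← Nat.add_mod, Nat.sub_add_cancel hs, Nat.mod_eq_zero_of_dvd hn]
    have hlt' : (n - s) % a < a := Nat.mod_lt _ (by omega)
    rcases Nat.lt_or_ge ((n - s) % a + s % a) a with h | h
    · rw [Nat.mod_eq_of_lt h] at key
      rw [if_pos (by omega)]; omega
    · rw [Nat.mod_eq_sub_mod h, Nat.mod_eq_of_lt (by omega)] at key
      rw [if_neg (by omega)]; omega
  simp only [periodicParabola, h]
  split_ifs with h0
  · simp [h0]
  · push_cast [Nat.cast_sub hlt.le]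
    ring

theorem potential_symm {n a s : ℕ} (ha : 2 ≤ a) (hn : a ∣ n) (hs : s ≤ n) :
    potential n a (n - s) = potential n a s := by
  simp only [potential, periodicParabola_symm ha hn hs, Nat.sub_sub_self hs]
  push_cast [Nat.cast_sub hs]
  ring

theorem potential_self {n a : ℕ} (ha : 2 ≤ a) (han : a ∣ n) (hn : a ≤ n) :
    potential n a n = 0 := by
  have := potential_symm ha han (Nat.zero_le n)
  rwa [Nat.sub_zero, potential_zero ha hn] at this

/-- Summation by parts, applied twice. -/
theorem sum_second_difference_mul_pow (w : ℕ → ℝ) (x : ℝ) (n : ℕ) :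
    ∑ s ∈ Finset.range n, (w (s + 2) - 2 * w (s + 1) + w s) * x ^ (s + 1)
      = (1 - x) ^ 2 * ∑ s ∈ Finset.range n, w (s + 1) * x ^ s
        + w 0 * x - w 1 + w (n + 1) * x ^ n - w n * x ^ (n + 1) := by
  induction n with
  | zero => simp
  | succ n ih =>
    rw [Finset.sum_range_succ, ih, Finset.sum_range_succ]
    ring

/-! ### Generating polynomials -/

theorem sum_sub_mul_pow (x : ℝ) (a : ℕ) :
    (1 - x) ^ 2 * ∑ i ∈ Finset.range a, ((a - i : ℕ) : ℝ) * x ^ i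
      = a - (a + 1) * x + x ^ (a + 1) := by
  induction a with
  | zero => simp
  | succ a ih =>
    rw [Finset.sum_range_succ']
    have : ∑ i ∈ Finset.range a, ((a + 1 - (i + 1) : ℕ) : ℝ) * x ^ (i + 1)
        = x * ∑ i ∈ Finset.range a, ((a - i : ℕ) : ℝ) * x ^ i := by
      rw [Finset.mul_sum]
      refine Finset.sum_congr rfl fun i _ => ?_
      rw [Nat.add_sub_add_right]
      ring
    rw [this, mul_add, mul_left_comm, ih]
    push_cast
    ring

theorem sum_mul_pow (x : ℝ) (a : ℕ) :
    (1 - x) ^ 2 * ∑ i ∈ Finset.range a, (i : ℝ) * x ^ i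
      = x - a * x ^ a + (a - 1) * x ^ (a + 1) := by
  induction a with
  | zero => simp
  | succ a ih =>
    rw [Finset.sum_range_succ, mul_add, ih]
    push_cast
    ring

theorem sum_range_mul {M : Type*} [AddCommMonoid M] (f : ℕ → M) (A B : ℕ) :
    ∑ i ∈ Finset.range (A * B), f i
      = ∑ u ∈ Finset.range A, ∑ w ∈ Finset.range B, f (u * B + w) := by
  induction A with
  | zero => simp
  | succ A ih => rw [Nat.succ_mul, Finset.sum_range_add, ih, Finset.sum_range_succ]

theorem sum_dvd_pow {a : ℕ} (ha : 2 ≤ a) (b : ℕ) (x : ℝ) :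
    (1 - x ^ a) * ∑ i ∈ Finset.range (a * b), (if a ∣ i then 1 else 0) * x ^ i
      = 1 - x ^ (a * b) := by
  rw [mul_comm a b, sum_range_mul]
  have : ∀ u ∈ Finset.range b, ∑ w ∈ Finset.range a,
      (if a ∣ u * a + w then (1 : ℝ) else 0) * x ^ (u * a + w) = (x ^ a) ^ u := by
    intro u _
    rw [Finset.sum_eq_single_of_mem 0 (Finset.mem_range.2 (by omega))]
    · simp [← pow_mul, mul_comm]
    · intro w hw hw0
      rw [if_neg, zero_mul]
      rw [Nat.dvd_add_right (Nat.dvd_mul_left a u)]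
      exact fun h => hw0 (Nat.eq_zero_of_dvd_of_lt h (Finset.mem_range.1 hw))
  rw [Finset.sum_congr rfl this, mul_neg_geom_sum, ← pow_mul, mul_comm a b]

/-- The generating polynomial of `kinkWeight` in closed form, multiplied by the denominators. On the
right-hand side, only the first and the last term distinguish `a` from `b` once the common factor
`a * (1 - x ^ a)` is removed. -/
theorem sum_kinkWeight {a b : ℕ} (ha : 2 ≤ a) (hb : 2 ≤ b) (x : ℝ) :
    a * (1 - x ^ a) * ((1 - x) ^ 2
      * ∑ i ∈ Finset.range (a * b - 1), kinkWeight (a * b) a (i + 1) * x ^ (i + 1))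
      = a * (1 - x) ^ 2 * (x ^ a - x ^ (a * b))
        + (1 - x ^ a) * (a * x * (1 - x) * (1 - x ^ (a * b - 1))
          - x * (1 - x ^ a) * (1 - x ^ (a * b - a))) := by
  have ha0 : (a : ℝ) ≠ 0 := by positivity
  have hab : a + 2 ≤ a * b := by nlinarith
  have h1 := sum_dvd_pow ha b x
  have h2 := sum_sub_mul_pow x a
  have h3 := sum_mul_pow x a
  obtain ⟨k, hk⟩ := Nat.exists_eq_add_of_le (show a ≤ a * b by omega)
  have e1 : ∑ i ∈ Finset.range (a * b), ((a - i : ℕ) : ℝ) * x ^ i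
      = ∑ i ∈ Finset.range a, ((a - i : ℕ) : ℝ) * x ^ i := by
    rw [hk, Finset.sum_range_add, add_eq_left]
    refine Finset.sum_eq_zero fun i _ => ?_
    rw [show a - (a + i) = 0 by omega]
    simp
  have e2 : ∑ i ∈ Finset.range (a * b), ((a - (a * b - i) : ℕ) : ℝ) * x ^ i
      = x ^ k * ∑ i ∈ Finset.range a, (i : ℝ) * x ^ i := by
    rw [hk, add_comm a k, Finset.sum_range_add, Finset.mul_sum, Finset.sum_eq_zero, zero_add]
    · refine Finset.sum_congr rfl fun i hi => ?_
      rw [Finset.mem_range] at hi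
      rw [show a - (k + a - (k + i)) = i by omega]
      ring
    · intro i hi
      rw [Finset.mem_range] at hi
      rw [show a - (k + a - i) = 0 by omega]
      simp
  have e3 : ∑ i ∈ Finset.range (a * b - 1), kinkWeight (a * b) a (i + 1) * x ^ (i + 1)
      = ∑ i ∈ Finset.range (a * b), (if a ∣ i then 1 else 0) * x ^ i
        + (∑ i ∈ Finset.range (a * b), ((a - i : ℕ) : ℝ) * x ^ i) / a
        + (∑ i ∈ Finset.range (a * b), ((a - (a * b - i) : ℕ) : ℝ) * x ^ i) / a - 2 := by
    have : a * b = (a * b - 1) + 1 := by omega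
    have h0 : kinkWeight (a * b) a 0 = 2 := by
      simp [kinkWeight, show a - a * b = 0 by omega, ha0]
      norm_num
    rw [eq_sub_iff_add_eq, Finset.sum_div, Finset.sum_div, ← Finset.sum_add_distrib,
      ← Finset.sum_add_distrib]
    conv_rhs => rw [this, Finset.sum_range_succ']
    rw [← this]
    congr 1
    · refine Finset.sum_congr rfl fun i _ => ?_
      simp only [kinkWeight]
      ring
    · rw [← h0]
      simp only [kinkWeight]
      ring
  rw [e3, e1, e2]
  have p1 : x ^ (a * b - 1) * x = x ^ (a * b) := by
    rw [← pow_succ]; congr 1; omega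
  have p2 : x ^ (a * b) = x ^ k * x ^ a := by rw [← pow_add]; congr 1; omega
  rw [show a * b - a = k by omega]
  set A := ∑ i ∈ Finset.range (a * b), (if a ∣ i then (1 : ℝ) else 0) * x ^ i
  set B := ∑ i ∈ Finset.range a, ((a - i : ℕ) : ℝ) * x ^ i
  set C := ∑ i ∈ Finset.range a, (i : ℝ) * x ^ i
  have : (a : ℝ) * (1 - x ^ a) * ((1 - x) ^ 2 * (A + B / a + x ^ k * C / a - 2))
      = a * (1 - x) ^ 2 * ((1 - x ^ a) * A) + (1 - x ^ a) * ((1 - x) ^ 2 * B)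
        + (1 - x ^ a) * x ^ k * ((1 - x) ^ 2 * C) - 2 * (a * (1 - x ^ a) * (1 - x) ^ 2) := by
    field_simp
  rw [this, h1, h2, h3]
  have p3 : x * x ^ (a * b - 1) = x ^ k * x ^ a := by rw [mul_comm, p1, p2]
  have p4 : a * x * (1 - x) * (1 - x ^ (a * b - 1)) = a * (1 - x) * (x - x ^ k * x ^ a) := by
    rw [← p3]; ring
  rw [p4, p2]
  ring

/-! ### Comparison of the potentials -/

theorem periodicParabola_le {a : ℕ} (ha : 2 ≤ a) (s : ℕ) : periodicParabola a s ≤ a / 8 := by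
  have ha0 : (0 : ℝ) < a := by positivity
  rw [periodicParabola, div_le_div_iff₀ (by positivity) (by norm_num)]
  nlinarith [sq_nonneg ((a : ℝ) - 2 * (s % a : ℕ))]

theorem periodicParabola_of_lt {a s : ℕ} (h : s < a) :
    periodicParabola a s = s * (a - s) / (2 * a) := by
  rw [periodicParabola, Nat.mod_eq_of_lt h]

theorem periodicParabola_self (a : ℕ) : periodicParabola a a = 0 := by
  simp [periodicParabola]

/-- For `n = a * b`, all terms on the right-hand side but the last add up to an expression that is
symmetric in `a` and `b`. -/
theorem potential_of_le {n a s : ℕ} (ha : 2 ≤ a) (hs : s ≤ a) (hn : a ≤ n - s) :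
    potential n a s
      = s * (n - s) / (2 * a) - s ^ 2 / 2 + s * a / 2
        - s * (a - s) / (2 * a) + s * (s ^ 2 - 1) / (6 * a) := by
  have ha0 : (a : ℝ) ≠ 0 := by positivity
  have hr : periodicParabola a s = s * (a - s) / (2 * a) := by
    rcases hs.lt_or_eq with h | h
    · exact periodicParabola_of_lt h
    · rw [h, periodicParabola_self]; simp
  rw [potential, hr, show a - (n - s) = 0 by omega]
  simp only [tetra]
  push_cast [Nat.cast_sub hs]
  field_simp
  ring

theorem potential_of_ge {n a s : ℕ} (hs : a ≤ s) (hn : a ≤ n - s) :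
    potential n a s
      = s * (n - s) / (2 * a) + ((a : ℝ) ^ 2 - 1) / 6 - periodicParabola a s := by
  rw [potential, show a - (n - s) = 0 by omega, show a - s = 0 by omega]
  simp [tetra]

/-- For `b = s`, the right-hand side minus the left-hand side is
`potential (a * b) a b - potential (a * b) b b`. The bound fails exactly at `(a, s) = (2, 3)` and
`(3, 4)`, which makes the pairs `(2, 3)` and `(3, 4)` of cardinalities exceptional. -/
theorem middle_bound {a s : ℕ} (ha : 2 ≤ a) (has : a < s) (h : ¬ (a ≤ 3 ∧ s = a + 1)) :
    periodicParabola a s ≤ (s - a) * (s * (a - 1) / (2 * a) - (a + s) / 6) := by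
  have ha0 : (0 : ℝ) < a := by positivity
  obtain ⟨d, rfl⟩ := Nat.exists_eq_add_of_lt has
  have hd0 : (0 : ℝ) ≤ d := by positivity
  rcases Nat.eq_zero_or_pos d with rfl | hd
  · have h1 : periodicParabola a (a + 0 + 1) = (a - 1) / (2 * a) := by
      rw [periodicParabola, add_zero, Nat.add_mod_left, Nat.mod_eq_of_lt (by omega)]
      push_cast; ring
    have h4 : (4 : ℝ) ≤ a := by exact_mod_cast (by omega : 4 ≤ a)
    rw [h1]
    push_cast
    rw [← sub_nonneg]
    have : ((a : ℝ) + 0 + 1 - a) * ((a + 0 + 1) * (a - 1) / (2 * a) - (a + (a + 0 + 1)) / 6)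
        - (a - 1) / (2 * a) = (a - 4) / 6 := by
      field_simp; ring
    rw [this]; linarith
  · have hd1 : (1 : ℝ) ≤ d := by exact_mod_cast hd
    rcases (by omega : a = 2 ∨ 3 ≤ a) with rfl | h3
    · rcases Nat.even_or_odd d with ⟨e, rfl⟩ | ⟨e, rfl⟩
      · have he : (1 : ℝ) ≤ e := by exact_mod_cast (by omega : 1 ≤ e)
        have : periodicParabola 2 (2 + (e + e) + 1) = 1 / 4 := by
          rw [periodicParabola, show (2 + (e + e) + 1) % 2 = 1 by omega]; norm_num
        rw [this]
        push_cast
        nlinarith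
      · have : periodicParabola 2 (2 + (2 * e + 1) + 1) = 0 := by
          rw [periodicParabola, show (2 + (2 * e + 1) + 1) % 2 = 0 by omega]; norm_num
        rw [this]
        have he : (0 : ℝ) ≤ e := by positivity
        push_cast
        nlinarith
    · have h3' : (3 : ℝ) ≤ a := by exact_mod_cast h3
      refine (periodicParabola_le ha _).trans ?_
      push_cast
      rw [← sub_nonneg]
      have : ((a : ℝ) + d + 1 - a) * ((a + d + 1) * (a - 1) / (2 * a) - (a + (a + d + 1)) / 6)
          - a / 8 = ((d + 1) * (8 * (a + d + 1) * a - 12 * (a + d + 1) - 4 * a ^ 2) - 3 * a ^ 2)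
            / (24 * a) := by
        field_simp; ring
      rw [this]
      apply div_nonneg _ (by positivity)
      obtain ⟨u, hu'⟩ : ∃ u : ℝ, (a : ℝ) = u + 3 := ⟨a - 3, by ring⟩
      obtain ⟨v, hv⟩ : ∃ v : ℝ, (d : ℝ) = v + 1 := ⟨d - 1, by ring⟩
      have hu : 0 ≤ u := by linarith
      have hv0 : 0 ≤ v := by linarith
      rw [hv, hu']
      ring_nf
      positivity

/-- On the left half of `{0, …, a * b}`, the smaller cardinality has the larger potential, apart
from the pairs `(2, 3)` and `(3, 4)`. -/
theorem potential_le {a b s : ℕ} (ha : 2 ≤ a) (hab : a < b) (h : ¬ (a ≤ 3 ∧ b = a + 1))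
    (hs : 2 * s ≤ a * b) : potential (a * b) b s ≤ potential (a * b) a s := by
  have hb : 2 ≤ b := by omega
  have ha0 : (0 : ℝ) < a := by positivity
  have hb0 : (0 : ℝ) < b := by positivity
  have hab' : (a : ℝ) + 1 ≤ b := by exact_mod_cast hab
  have ha2 : (2 : ℝ) ≤ a := by exact_mod_cast ha
  have hn : 2 * b ≤ a * b := Nat.mul_le_mul_right b ha
  have hs0 : (0 : ℝ) ≤ s := by positivity
  rcases le_or_gt s b with hsb | hsb
  · have hV := potential_of_le hb hsb (by omega : b ≤ a * b - s)
    rcases le_or_gt s a with hsa | hsa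
    · have hU := potential_of_le ha hsa (by omega : a ≤ a * b - s)
      rw [hU, hV, ← sub_nonneg]
      push_cast
      rcases Nat.eq_zero_or_pos s with rfl | hs1
      · simp
      have hs1 : (1 : ℝ) ≤ s := by exact_mod_cast hs1
      have : (0 : ℝ) ≤ s * (s ^ 2 - 1) * (b - a) / (6 * a * b) := by
        apply div_nonneg _ (by positivity)
        apply mul_nonneg (mul_nonneg hs0 (by nlinarith)) (by linarith)
      convert this using 1
      field_simp
      ring
    · have hU := potential_of_ge hsa.le (by omega : a ≤ a * b - s)
      -- the worst case of the last term is `b = s`, which leaves the bound of `middle_bound`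
      have key : periodicParabola a s
          ≤ s * (s - a) * (a - 1) / (2 * a) + ((a : ℝ) ^ 2 - 1) / 6
            - s * (s ^ 2 - 1) / (6 * b) := by
        -- at `s = a + 1` with `a ≤ 3` that is not enough, and `a + 2 ≤ b` has to be used
        by_cases hc : a ≤ 3 ∧ s = a + 1
        · obtain ⟨hc1, rfl⟩ := hc
          have hb2 : (a : ℝ) + 2 ≤ b := by exact_mod_cast (by omega : a + 2 ≤ b)
          have h1 : periodicParabola a (a + 1) = (a - 1) / (2 * a) := by
            rw [periodicParabola, Nat.add_mod_left, Nat.mod_eq_of_lt (by omega)]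
            push_cast; ring
          have h2 : ((a + 1 : ℕ) : ℝ) * ((a + 1 : ℕ) ^ 2 - 1) / (6 * b)
              ≤ ((a + 1 : ℕ) : ℝ) * ((a + 1 : ℕ) ^ 2 - 1) / (6 * (a + 2)) := by
            gcongr
            push_cast
            nlinarith
          rw [h1]
          refine le_trans ?_ (sub_le_sub_left h2 _)
          have : a = 2 ∨ a = 3 := by omega
          rcases this with rfl | rfl <;> norm_num
        · refine (middle_bound ha hsa hc).trans ?_
          have hsb' : (s : ℝ) ≤ b := by exact_mod_cast hsb
          have hs1 : (1 : ℝ) ≤ s := by exact_mod_cast (by omega : 1 ≤ s)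
          have h2 : (s : ℝ) * (s ^ 2 - 1) / (6 * b) ≤ s * (s ^ 2 - 1) / (6 * s) := by
            gcongr
            nlinarith
          refine le_trans (le_of_eq ?_) (sub_le_sub_left h2 _)
          field_simp
          ring
      rw [hU, hV, ← sub_nonneg]
      push_cast
      rw [← sub_nonneg] at key
      convert key using 1
      field_simp
      ring
  -- now `b < s ≤ a * b / 2`, which is impossible for `a = 2`
  · have h3 : 3 ≤ a := by
      by_contra hc
      have : a = 2 := by omega
      subst this
      omega
    have h3' : (3 : ℝ) ≤ a := by exact_mod_cast h3
    have hU := potential_of_ge (by omega : a ≤ s) (by omega : a ≤ a * b - s)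
    have hV := potential_of_ge (by omega : b ≤ s) (by omega : b ≤ a * b - s)
    have hP : 0 ≤ periodicParabola b s := by
      have : s % b < b := Nat.mod_lt _ (by omega)
      have : ((s % b : ℕ) : ℝ) ≤ b := by exact_mod_cast this.le
      unfold periodicParabola
      apply div_nonneg (mul_nonneg (by positivity) (by linarith)) (by positivity)
    have hQ := periodicParabola_le ha s
    have hsb' : (b : ℝ) + 1 ≤ s := by exact_mod_cast hsb
    have hs' : 2 * (s : ℝ) ≤ a * b := by exact_mod_cast hs
    -- `s * (a * b - s)` increases up to `a * b / 2`, so its least value is at `s = b + 1`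
    have hprod : ((b : ℝ) + 1) * (a * b - b - 1) ≤ s * (a * b - s) := by nlinarith
    have key : (a : ℝ) / 8 ≤ (b - a) * (((b : ℝ) + 1) * (a * b - b - 1)) / (2 * a * b)
        - (b ^ 2 - a ^ 2) / 6 := by
      rw [← sub_nonneg]
      have : ((b : ℝ) - a) * (((b : ℝ) + 1) * (a * b - b - 1)) / (2 * a * b)
        - (b ^ 2 - a ^ 2) / 6 - a / 8 = ((b - a) * (12 * ((b + 1) * (a * b - b - 1))
          - 4 * a * b * (a + b)) - 3 * a ^ 2 * b) / (24 * a * b) := by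
        field_simp; ring
      rw [this]
      apply div_nonneg _ (by positivity)
      rcases (by omega : (4 ≤ a ∧ a + 1 ≤ b) ∨ (a = 3 ∧ 5 ≤ b)) with ⟨h4, h5⟩ | ⟨rfl, h5⟩
      · obtain ⟨u, rfl⟩ := Nat.exists_eq_add_of_le h4
        obtain ⟨v, rfl⟩ := Nat.exists_eq_add_of_le h5
        push_cast
        ring_nf
        positivity
      · obtain ⟨v, rfl⟩ := Nat.exists_eq_add_of_le h5
        push_cast
        ring_nf
        positivity
    have key2 : ((b : ℝ) - a) * (((b : ℝ) + 1) * (a * b - b - 1)) / (2 * a * b)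
        ≤ (b - a) * (s * (a * b - s)) / (2 * a * b) := by
      gcongr
      linarith
    have e : (s : ℝ) * (a * b - s) / (2 * a) - s * (a * b - s) / (2 * b)
        = (b - a) * (s * (a * b - s)) / (2 * a * b) := by
      field_simp
    rw [hU, hV]
    push_cast
    linarith

/-! ### Exchanging two adjacent columns -/

/-- The expected number of runs per prefix, without boundary effects, in a column with `n` values
that is preceded by many prefixes, if every extension of a prefix by a value of the column is
missing with probability `x`: of the `n (1 - x)` expected blocks of equal entries, the subtracted
term counts those that continue the run which ends the previous nonempty prefix. At `x = 1` the
quotient is `0 / 0 = 0` and the cost is `0`, as it should be for an empty table. -/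
noncomputable def columnCost (n : ℕ) (x : ℝ) : ℝ :=
  n * (1 - x) - n * (1 - x) ^ 2 * x ^ (n - 1) / (1 - x ^ n)

theorem potential_one {n a : ℕ} (ha : 2 ≤ a) (hn : a < n) :
    potential n a 1 = ((n : ℝ) / a + a) / 2 - 1 := by
  have ha0 : (a : ℝ) ≠ 0 := by positivity
  rw [potential_of_le ha (by omega) (by omega)]
  push_cast
  field_simp
  ring

theorem kink_sum_le {a b : ℕ} (ha : 2 ≤ a) (hab : a < b) (h : ¬ (a ≤ 3 ∧ b = a + 1)) {x : ℝ}
    (hx : 0 ≤ x) :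
    ∑ i ∈ Finset.range (a * b - 1), kinkWeight (a * b) a (i + 1) * x ^ (i + 1)
      ≤ ∑ i ∈ Finset.range (a * b - 1), kinkWeight (a * b) b (i + 1) * x ^ (i + 1) := by
  have hb : 2 ≤ b := by omega
  have ha0 : (a : ℝ) ≠ 0 := by positivity
  have hb0 : (b : ℝ) ≠ 0 := by positivity
  have hn : 2 * b ≤ a * b := Nat.mul_le_mul_right b ha
  have main : ∀ s ≤ a * b, potential (a * b) b s ≤ potential (a * b) a s := by
    intro s hs
    rcases le_total (2 * s) (a * b) with h' | h'
    · exact potential_le ha hab h h'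
    · rw [← potential_symm ha (Nat.dvd_mul_right a b) hs,
        ← potential_symm hb (Nat.dvd_mul_left b a) hs]
      exact potential_le ha hab h (by omega)
  -- the boundary terms of the summation by parts vanish for the difference of the potentials
  set w : ℕ → ℝ := fun s => potential (a * b) a s - potential (a * b) b s with hw
  have w0 : w 0 = 0 := by
    simp [hw, potential_zero ha (by omega : a ≤ a * b), potential_zero hb (by omega : b ≤ a * b)]
  have wn : w (a * b) = 0 := by
    simp [hw, potential_self ha (Nat.dvd_mul_right a b) (by omega),
      potential_self hb (Nat.dvd_mul_left b a) (by omega)]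
  have w1 : w 1 = 0 := by
    simp only [hw]
    rw [potential_one ha (by omega), potential_one hb (by omega)]
    push_cast
    field_simp
    ring
  have wn1 : w (a * b - 1) = 0 := by
    simp only [hw] at w1 ⊢
    rw [potential_symm ha (Nat.dvd_mul_right a b) (by omega),
      potential_symm hb (Nat.dvd_mul_left b a) (by omega), w1]
  have key := sum_second_difference_mul_pow w x (a * b - 1)
  rw [Nat.sub_add_cancel (by omega), w0, w1, wn, wn1] at key
  rw [← sub_nonneg, ← Finset.sum_sub_distrib]
  have e : ∑ i ∈ Finset.range (a * b - 1), (kinkWeight (a * b) b (i + 1) * x ^ (i + 1)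
      - kinkWeight (a * b) a (i + 1) * x ^ (i + 1))
      = ∑ s ∈ Finset.range (a * b - 1), (w (s + 2) - 2 * w (s + 1) + w s) * x ^ (s + 1) := by
    refine Finset.sum_congr rfl fun i hi => ?_
    rw [Finset.mem_range] at hi
    have h1 := potential_second_difference ha (by omega : i + 2 ≤ a * b)
    have h2 := potential_second_difference hb (by omega : i + 2 ≤ a * b)
    rw [← sub_mul]
    congr 1
    simp only [hw]
    linarith
  rw [e, key]
  have : 0 ≤ ∑ s ∈ Finset.range (a * b - 1), w (s + 1) * x ^ s := by
    refine Finset.sum_nonneg fun s hs => ?_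
    rw [Finset.mem_range] at hs
    have := main (s + 1) (by omega)
    apply mul_nonneg _ (by positivity)
    simp only [hw]
    linarith
  have := mul_nonneg (sq_nonneg (1 - x)) this
  linarith

/-- Of two adjacent columns, the one with fewer values should come first. Here `x = q ^ ρ`, with `ρ`
the product of the cardinalities of the columns after the two. -/
theorem columnCost_swap {a b : ℕ} (ha : 2 ≤ a) (hab : a ≤ b) {x : ℝ} (hx0 : 0 ≤ x) (hx1 : x ≤ 1) :
    columnCost a (x ^ b) + a * columnCost b x ≤ columnCost b (x ^ a) + b * columnCost a x := by
  rcases hab.eq_or_lt with rfl | hab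
  · exact le_rfl
  have hb : 2 ≤ b := by omega
  have ha0 : (0 : ℝ) < a := by positivity
  have hb0 : (0 : ℝ) < b := by positivity
  rcases hx1.eq_or_lt with rfl | hx1
  · simp [columnCost]
  rcases hx0.eq_or_lt with rfl | hx0
  · have : (a : ℝ) ≤ b := by exact_mod_cast hab.le
    simp only [columnCost, zero_pow (by omega : a ≠ 0), zero_pow (by omega : b ≠ 0),
      zero_pow (by omega : a - 1 ≠ 0), zero_pow (by omega : b - 1 ≠ 0)]
    norm_num
    nlinarith
  have hA : x ^ a < 1 := pow_lt_one₀ hx0.le hx1 (by omega)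
  have hB : x ^ b < 1 := pow_lt_one₀ hx0.le hx1 (by omega)
  have hN : x ^ (a * b) < 1 := pow_lt_one₀ hx0.le hx1 (by positivity)
  have hA0 : 0 < x ^ a := by positivity
  have hB0 : 0 < x ^ b := by positivity
  -- the claim multiplied by `x (1 - x ^ (a b)) / (a b)`, without the terms common to both sides
  have red : (1 - x) ^ 2 * (x ^ a - x ^ (a * b)) / (1 - x ^ a)
        - x * (1 - x ^ a) * (1 - x ^ (a * b) / x ^ a) / a
      ≤ (1 - x) ^ 2 * (x ^ b - x ^ (a * b)) / (1 - x ^ b)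
        - x * (1 - x ^ b) * (1 - x ^ (a * b) / x ^ b) / b := by
    by_cases hsp : a ≤ 3 ∧ b = a + 1
    · obtain ⟨h3, rfl⟩ := hsp
      rcases (by omega : a = 2 ∨ a = 3) with rfl | rfl
      · have hA' : 1 - x ^ 2 ≠ 0 := (sub_pos.2 hA).ne'
        have hB' : 1 - x ^ 3 ≠ 0 := (sub_pos.2 hB).ne'
        rw [← sub_nonneg]
        refine le_of_le_of_eq (by positivity : 0 ≤ x * (1 - x) ^ 6 / 6) ?_
        norm_num
        field_simp
        ring
      · have hA' : 1 - x ^ 3 ≠ 0 := (sub_pos.2 hA).ne'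
        have hB' : 1 - x ^ 4 ≠ 0 := (sub_pos.2 hB).ne'
        rw [← sub_nonneg]
        have hx2 : 0 ≤ 1 - x := by linarith
        refine le_of_le_of_eq (by positivity :
          0 ≤ x * (1 - x) ^ 4 * (1 + 2 * x + 2 * x * (1 - x) + 4 * x ^ 3 + 10 * x ^ 4 + 2 * x ^ 5
            + 2 * x ^ 5 * (1 - x) + 4 * x ^ 7 + x ^ 8) / 12) ?_
        norm_num
        field_simp
        ring
    · have key := mul_le_mul_of_nonneg_left (kink_sum_le ha hab hsp hx0.le) (sq_nonneg (1 - x))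
      have h1 := sum_kinkWeight ha hb x
      have h2 := sum_kinkWeight hb ha x
      rw [mul_comm b a] at h2
      have e1 : x ^ (a * b - a) = x ^ (a * b) / x ^ a := by
        rw [eq_div_iff hA0.ne', ← pow_add,
          Nat.sub_add_cancel (Nat.le_mul_of_pos_right a (by omega))]
      have e2 : x ^ (a * b - b) = x ^ (a * b) / x ^ b := by
        rw [eq_div_iff hB0.ne', ← pow_add, Nat.sub_add_cancel (Nat.le_mul_of_pos_left b (by omega))]
      rw [e1] at h1
      rw [e2] at h2
      have h1' := eq_div_of_mul_eq (mul_pos ha0 (sub_pos.2 hA)).ne' ((mul_comm _ _).trans h1)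
      have h2' := eq_div_of_mul_eq (mul_pos hb0 (sub_pos.2 hB)).ne' ((mul_comm _ _).trans h2)
      rw [h1', h2'] at key
      have hA' := (sub_pos.2 hA).ne'
      have hB' := (sub_pos.2 hB).ne'
      rw [← sub_nonneg] at key ⊢
      refine le_of_le_of_eq key ?_
      field_simp
      ring
  have e1 : x ^ (a - 1) = x ^ a / x := by
    rw [eq_div_iff hx0.ne', ← pow_succ, Nat.sub_add_cancel (by omega)]
  have e2 : x ^ (b - 1) = x ^ b / x := by
    rw [eq_div_iff hx0.ne', ← pow_succ, Nat.sub_add_cancel (by omega)]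
  have e3 : (x ^ b) ^ (a - 1) = x ^ (a * b) / x ^ b := by
    rw [eq_div_iff hB0.ne', ← pow_succ, Nat.sub_add_cancel (by omega), ← pow_mul, mul_comm]
  have e4 : (x ^ a) ^ (b - 1) = x ^ (a * b) / x ^ a := by
    rw [eq_div_iff hA0.ne', ← pow_succ, Nat.sub_add_cancel (by omega), ← pow_mul]
  have e5 : (x ^ b) ^ a = x ^ (a * b) := by rw [← pow_mul, mul_comm]
  have e6 : (x ^ a) ^ b = x ^ (a * b) := by rw [← pow_mul]
  simp only [columnCost, e1, e2, e3, e4, e5, e6]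
  have hA' := sub_pos.2 hA
  have hB' := sub_pos.2 hB
  have hN' := sub_pos.2 hN
  rw [← sub_nonneg] at red ⊢
  have := mul_nonneg (by positivity : (0 : ℝ) ≤ a * b / (x * (1 - x ^ (a * b)))) red
  refine le_of_le_of_eq this ?_
  generalize x ^ a = A at *
  generalize x ^ b = B at *
  generalize x ^ (a * b) = C at *
  have hA'' := hA'.ne'
  have hB'' := hB'.ne'
  have hN'' := hN'.ne'
  field_simp
  ring

/-! ### Pairs of integers with an equal digit -/

/-- `∑_{m < m' < M} y ^ (m' - m - 1)`. -/
def gapSum (M : ℕ) (y : ℝ) : ℝ :=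
  ∑ m ∈ Finset.range M, ∑ m' ∈ Finset.range M, if m < m' then y ^ (m' - m - 1) else 0

theorem gapSum_succ (M : ℕ) (y : ℝ) :
    gapSum (M + 1) y = gapSum M y + ∑ i ∈ Finset.range M, y ^ i := by
  have h1 : ∀ m ∈ Finset.range M, (∑ m' ∈ Finset.range (M + 1),
      if m < m' then y ^ (m' - m - 1) else 0)
      = (∑ m' ∈ Finset.range M, if m < m' then y ^ (m' - m - 1) else 0) + y ^ (M - 1 - m) := by
    intro m hm
    rw [Finset.sum_range_succ, if_pos (Finset.mem_range.1 hm), Nat.sub_right_comm]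
  have h2 : ∑ m' ∈ Finset.range (M + 1), (if M < m' then y ^ (m' - M - 1) else 0) = 0 := by
    refine Finset.sum_eq_zero fun m' hm => if_neg ?_
    rw [Finset.mem_range] at hm
    omega
  rw [gapSum, Finset.sum_range_succ, h2, add_zero, Finset.sum_congr rfl h1,
    Finset.sum_add_distrib, Finset.sum_range_reflect (fun i => y ^ i)]
  rfl

theorem gapSum_mul_sq (M : ℕ) (y : ℝ) :
    gapSum M y * (1 - y) ^ 2 = M * (1 - y) - (1 - y ^ M) := by
  induction M with
  | zero => simp [gapSum]
  | succ M ih =>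
    have := geom_sum_mul_neg y M
    rw [gapSum_succ, add_mul, ih, pow_two, ← mul_assoc, this]
    push_cast
    ring

/-- The sum of `q ^ (j - i - 1)` over the pairs `i < j` with the same digit. The integers are cut
into blocks of `ρ` consecutive ones with a constant digit: the first term comes from pairs within a
block, the second from pairs in different blocks. -/
theorem sum_equal_digit {M n ρ : ℕ} (q : ℝ) :
    (1 - q) ^ 2 * ∑ i ∈ Finset.range (M * n * ρ), ∑ j ∈ Finset.range (M * n * ρ),
        (if i < j ∧ i / ρ % n = j / ρ % n then q ^ (j - i - 1) else 0)
      = M * n * (ρ * (1 - q) - (1 - q ^ ρ))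
        + n * (1 - q ^ ρ) ^ 2 * (q ^ ρ) ^ (n - 1) * gapSum M ((q ^ ρ) ^ n) := by
  rcases Nat.eq_zero_or_pos ρ with rfl | hρ
  · simp
  rcases Nat.eq_zero_or_pos n with rfl | hn
  · simp
  -- the contribution of two blocks
  have block : ∀ u u', (1 - q) ^ 2 * ∑ w ∈ Finset.range ρ, ∑ w' ∈ Finset.range ρ,
      (if u * ρ + w < u' * ρ + w' ∧ (u * ρ + w) / ρ % n = (u' * ρ + w') / ρ % n
        then q ^ (u' * ρ + w' - (u * ρ + w) - 1) else 0)
      = (if u = u' then ρ * (1 - q) - (1 - q ^ ρ) else 0)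
        + if u < u' ∧ u % n = u' % n then (1 - q ^ ρ) ^ 2 * (q ^ ρ) ^ (u' - u - 1) else 0 := by
    intro u u'
    have hdiv : ∀ u, ∀ w ∈ Finset.range ρ, (u * ρ + w) / ρ = u := by
      intro u w hw
      rw [mul_comm, Nat.mul_add_div hρ, Nat.div_eq_of_lt (Finset.mem_range.1 hw), add_zero]
    rcases lt_trichotomy u u' with h | rfl | h
    · rw [if_neg h.ne, zero_add]
      by_cases hd : u % n = u' % n
      · rw [if_pos ⟨h, hd⟩]
        have hle : u * ρ + ρ ≤ u' * ρ := by
          rw [← Nat.succ_mul]; exact Nat.mul_le_mul_right ρ h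
        have : ∀ w ∈ Finset.range ρ, ∑ w' ∈ Finset.range ρ,
            (if u * ρ + w < u' * ρ + w' ∧ (u * ρ + w) / ρ % n = (u' * ρ + w') / ρ % n
              then q ^ (u' * ρ + w' - (u * ρ + w) - 1) else 0)
            = ((q ^ ρ) ^ (u' - u - 1) * ∑ w' ∈ Finset.range ρ, q ^ w') * q ^ (ρ - 1 - w) := by
          intro w hw
          rw [Finset.mul_sum, Finset.sum_mul]
          refine Finset.sum_congr rfl fun w' hw' => ?_
          rw [hdiv u w hw, hdiv u' w' hw']
          rw [Finset.mem_range] at hw hw'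
          rw [if_pos ⟨by omega, hd⟩, ← pow_mul, ← pow_add, ← pow_add]
          congr 1
          have : ρ * (u' - u - 1) = u' * ρ - u * ρ - ρ := by
            rw [Nat.mul_sub, Nat.mul_sub, mul_one, mul_comm ρ, mul_comm ρ]
          omega
        rw [Finset.sum_congr rfl this, ← Finset.mul_sum,
          Finset.sum_range_reflect (fun i => q ^ i), ← mul_neg_geom_sum q ρ]
        ring
      · rw [if_neg (fun h => hd h.2)]
        rw [Finset.sum_eq_zero, mul_zero]
        intro w hw
        refine Finset.sum_eq_zero fun w' hw' => if_neg ?_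
        rw [hdiv u w hw, hdiv u' w' hw']
        exact fun h => hd h.2
    · rw [if_pos rfl, if_neg (fun h => lt_irrefl _ h.1), add_zero, ← gapSum_mul_sq, mul_comm,
        gapSum]
      congr 1
      refine Finset.sum_congr rfl fun w hw => Finset.sum_congr rfl fun w' hw' => ?_
      rw [hdiv u w hw, hdiv u w' hw', Nat.add_sub_add_left]
      simp
    · rw [if_neg h.ne', if_neg (fun h' => (h.trans h'.1).false), add_zero]
      rw [Finset.sum_eq_zero, mul_zero]
      intro w hw
      refine Finset.sum_eq_zero fun w' hw' => if_neg ?_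
      have hle : u' * ρ + ρ ≤ u * ρ := by
        rw [← Nat.succ_mul]; exact Nat.mul_le_mul_right ρ h
      rw [Finset.mem_range] at hw hw'
      omega
  have e1 : (1 - q) ^ 2 * ∑ i ∈ Finset.range (M * n * ρ), ∑ j ∈ Finset.range (M * n * ρ),
        (if i < j ∧ i / ρ % n = j / ρ % n then q ^ (j - i - 1) else 0)
      = ∑ u ∈ Finset.range (M * n), ∑ u' ∈ Finset.range (M * n),
        ((if u = u' then ρ * (1 - q) - (1 - q ^ ρ) else 0)
        + if u < u' ∧ u % n = u' % n then (1 - q ^ ρ) ^ 2 * (q ^ ρ) ^ (u' - u - 1) else 0) := by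
    rw [sum_range_mul, Finset.mul_sum]
    refine Finset.sum_congr rfl fun u _ => ?_
    simp_rw [← block u, sum_range_mul _ (M * n) ρ]
    rw [Finset.sum_comm, Finset.mul_sum]
  set x := q ^ ρ
  -- the blocks with numbers `m * n + v` and `m' * n + v'` have the same digit only if `v = v'`
  have e2 : ∀ m m', ∑ v ∈ Finset.range n, ∑ v' ∈ Finset.range n,
      (if m * n + v < m' * n + v' ∧ (m * n + v) % n = (m' * n + v') % n
        then (1 - x) ^ 2 * x ^ (m' * n + v' - (m * n + v) - 1) else 0)
      = n * (1 - x) ^ 2 * x ^ (n - 1) * if m < m' then (x ^ n) ^ (m' - m - 1) else 0 := by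
    intro m m'
    have hv : ∀ v ∈ Finset.range n, ∑ v' ∈ Finset.range n,
        (if m * n + v < m' * n + v' ∧ (m * n + v) % n = (m' * n + v') % n
          then (1 - x) ^ 2 * x ^ (m' * n + v' - (m * n + v) - 1) else 0)
        = (1 - x) ^ 2 * x ^ (n - 1) * if m < m' then (x ^ n) ^ (m' - m - 1) else 0 := by
      intro v hv
      rw [Finset.sum_eq_single_of_mem v hv]
      · rcases lt_or_ge m m' with h | h
        · have hle : m * n + n ≤ m' * n := by
            rw [← Nat.succ_mul]; exact Nat.mul_le_mul_right n h
          rw [if_pos h, if_pos ⟨by omega, by simp⟩, mul_assoc, ← pow_mul x n, ← pow_add]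
          congr 2
          have : n * (m' - m - 1) = m' * n - m * n - n := by
            rw [Nat.mul_sub, Nat.mul_sub, mul_one, mul_comm n, mul_comm n]
          omega
        · have hle : m' * n ≤ m * n := Nat.mul_le_mul_right n h
          rw [if_neg (by omega), if_neg (by omega), mul_zero]
      · intro v' hv' hne
        rw [Finset.mem_range] at hv hv'
        refine if_neg fun h => hne ?_
        have := h.2
        rwa [Nat.mul_add_mod', Nat.mul_add_mod', Nat.mod_eq_of_lt hv, Nat.mod_eq_of_lt hv',
          eq_comm] at this
    rw [Finset.sum_congr rfl hv, Finset.sum_const, Finset.card_range, nsmul_eq_mul]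
    ring
  rw [e1]
  simp_rw [Finset.sum_add_distrib]
  congr 1
  · have : ∀ u ∈ Finset.range (M * n), ∑ u' ∈ Finset.range (M * n),
        (if u = u' then ρ * (1 - q) - (1 - x) else 0) = ρ * (1 - q) - (1 - x) := fun u hu => by
      rw [Finset.sum_ite_eq, if_pos hu]
    rw [Finset.sum_congr rfl this, Finset.sum_const, Finset.card_range, nsmul_eq_mul]
    push_cast
    ring
  · rw [sum_range_mul, gapSum, Finset.mul_sum]
    refine Finset.sum_congr rfl fun m _ => ?_
    simp_rw [Finset.mul_sum, ← e2 m, sum_range_mul _ M n]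
    rw [Finset.sum_comm]

/-! ### The expected number of runs of a column up to a bounded error -/

theorem mul_pow_le_geom_sum_sq {n : ℕ} {x : ℝ} (hx : 0 ≤ x) :
    n * x ^ (n - 1) ≤ (∑ i ∈ Finset.range n, x ^ i) ^ 2 := by
  have : ∀ i ∈ Finset.range n, x ^ (n - 1) ≤ x ^ i * ∑ j ∈ Finset.range n, x ^ j := by
    intro i hi
    rw [Finset.mem_range] at hi
    have h1 : x ^ (n - 1 - i) ≤ ∑ j ∈ Finset.range n, x ^ j :=
      Finset.single_le_sum (f := fun j => x ^ j) (fun j _ => by positivity)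
        (Finset.mem_range.2 (by omega))
    calc x ^ (n - 1) = x ^ i * x ^ (n - 1 - i) := by rw [← pow_add]; congr 1; omega
      _ ≤ _ := by gcongr
  calc (n : ℝ) * x ^ (n - 1) = ∑ i ∈ Finset.range n, x ^ (n - 1) := by simp
    _ ≤ _ := Finset.sum_le_sum this
    _ = _ := by rw [← Finset.sum_mul, pow_two]

/-- The expected number of runs of a column with `n` values after `M` prefixes, if every extension
of a prefix by a value of the column is missing with probability `x`. -/
noncomputable def expectedColumnRuns (M n : ℕ) (x : ℝ) : ℝ :=
  M * n * (1 - x) - n * (1 - x) ^ 2 * x ^ (n - 1) * gapSum M (x ^ n)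

/-- The error is the boundary term of `gapSum_mul_sq`, and it is at most `1` by
`n x ^ (n - 1) ≤ (1 + x + ⋯ + x ^ (n - 1))²`. -/
theorem expectedColumnRuns_bounds (M : ℕ) {n : ℕ} (hn : 2 ≤ n) {x : ℝ} (hx0 : 0 ≤ x) (hx1 : x ≤ 1) :
    M * columnCost n x ≤ expectedColumnRuns M n x ∧
      expectedColumnRuns M n x ≤ M * columnCost n x + 1 := by
  rcases hx1.eq_or_lt with rfl | hx1
  · simp [expectedColumnRuns, columnCost]
  have hy : x ^ n < 1 := pow_lt_one₀ hx0 hx1 (by omega)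
  have hy0 : 0 ≤ x ^ n := by positivity
  have hyM : (x ^ n) ^ M ≤ 1 := pow_le_one₀ hy0 hy.le
  have hyM0 : 0 ≤ (x ^ n) ^ M := by positivity
  have hJ := gapSum_mul_sq M (x ^ n)
  have hpos : 0 < 1 - x ^ n := sub_pos.2 hy
  have hJ' := eq_div_of_mul_eq (pow_pos hpos 2).ne' hJ
  have hg : 1 - x ^ n = (1 - x) * ∑ i ∈ Finset.range n, x ^ i := (mul_neg_geom_sum x n).symm
  have hle : n * (1 - x) ^ 2 * x ^ (n - 1) ≤ (1 - x ^ n) ^ 2 := by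
    rw [hg, mul_pow]
    have := mul_le_mul_of_nonneg_left (mul_pow_le_geom_sum_sq (n := n) hx0) (sq_nonneg (1 - x))
    linarith
  have e : expectedColumnRuns M n x = M * columnCost n x
      + n * (1 - x) ^ 2 * x ^ (n - 1) / (1 - x ^ n) ^ 2 * (1 - (x ^ n) ^ M) := by
    rw [expectedColumnRuns, columnCost, hJ']
    have := hpos.ne'
    field_simp
    ring
  have h1 : n * (1 - x) ^ 2 * x ^ (n - 1) / (1 - x ^ n) ^ 2 ≤ 1 := by
    rw [div_le_one (by positivity)]; exact hle
  have h0 : 0 ≤ n * (1 - x) ^ 2 * x ^ (n - 1) / (1 - x ^ n) ^ 2 := by positivity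
  rw [e]
  constructor
  · have := mul_nonneg h0 (sub_nonneg.2 hyM)
    linarith
  · have := mul_le_mul h1 (sub_le_self 1 hyM0) (sub_nonneg.2 hyM) zero_le_one
    linarith

/-! ### Runs in a sorted random set -/

/-- The runs are counted by their first elements, the elements of `S` which do not agree under `f`
with the preceding element of `S`. -/
theorem numRuns_sort_add_card {α β : Type*} [LinearOrder α] [DecidableEq β] (f : α → β)
    (S : Finset α) :
    numRuns ((S.sort (· ≤ ·)).map f)
      + ((S ×ˢ S).filter fun z => z.1 < z.2 ∧ f z.1 = f z.2 ∧ ∀ k ∈ S, ¬ (z.1 < k ∧ k < z.2)).card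
      = S.card := by
  induction S using Finset.induction_on_min with
  | empty => simp [numRuns]
  | insert a s ha ih =>
    have has : a ∉ s := fun h => (ha a h).false
    rw [Finset.sort_insert (· ≤ ·) (fun b hb => (ha b hb).le) has,
      Finset.card_insert_of_notMem has, ← ih]
    rcases hl : s.sort (· ≤ ·) with _ | ⟨b, l⟩
    · have : s = ∅ := by
        rw [← Finset.card_eq_zero, ← Finset.length_sort (· ≤ ·), hl, List.length_nil]
      subst this
      simp [numRuns, Finset.filter_singleton]
    · have hb : b ∈ s := by rw [← Finset.mem_sort (· ≤ ·), hl]; exact List.mem_cons_self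
      have hmin : ∀ k ∈ s, b ≤ k := by
        intro k hk
        rw [← Finset.mem_sort (· ≤ ·), hl, List.mem_cons] at hk
        have hp := s.pairwise_sort (· ≤ ·)
        rw [hl, List.pairwise_cons] at hp
        rcases hk with rfl | hk
        · exact le_rfl
        · exact hp.1 k hk
      have hfil : ((insert a s ×ˢ insert a s).filter fun z => z.1 < z.2 ∧ f z.1 = f z.2 ∧
            ∀ k ∈ insert a s, ¬ (z.1 < k ∧ k < z.2))
          = ((s ×ˢ s).filter fun z => z.1 < z.2 ∧ f z.1 = f z.2 ∧ ∀ k ∈ s, ¬ (z.1 < k ∧ k < z.2))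
            ∪ if f a = f b then {(a, b)} else ∅ := by
        ext ⟨t, t'⟩
        simp only [Finset.mem_filter, Finset.mem_product, Finset.mem_insert, Finset.mem_union,
          forall_eq_or_imp]
        constructor
        · rintro ⟨⟨ht | ht, ht' | ht'⟩, hlt, hf, h1, h2⟩
          · subst ht; subst ht'; exact absurd hlt (lt_irrefl _)
          · subst ht
            have : t' = b := by
              by_contra hne
              exact h2 b hb ⟨ha b hb, lt_of_le_of_ne (hmin t' ht') (Ne.symm hne)⟩
            subst this
            right
            rw [if_pos hf]
            exact Finset.mem_singleton_self _
          · subst ht'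
            exact absurd hlt (ha t ht).not_gt
          · exact Or.inl ⟨⟨ht, ht'⟩, hlt, hf, h2⟩
        · rintro (⟨⟨ht, ht'⟩, hlt, hf, h2⟩ | h)
          · exact ⟨⟨Or.inr ht, Or.inr ht'⟩, hlt, hf, fun h => (ha t ht).not_gt h.1, h2⟩
          · split_ifs at h with hf
            · rw [Finset.mem_singleton, Prod.mk.injEq] at h
              obtain ⟨rfl, rfl⟩ := h
              exact ⟨⟨Or.inl rfl, Or.inr hb⟩, ha _ hb, hf, fun h => lt_irrefl _ h.1,
                fun k hk h => (hmin k hk).not_gt h.2⟩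
            · simp at h
      rw [hfil, Finset.card_union_of_disjoint]
      · simp only [List.map_cons, numRuns]
        split_ifs with hf
        · rw [Finset.card_singleton]; ring
        · rw [Finset.card_empty]; ring
      · rw [Finset.disjoint_left]
        intro z hz hz'
        split_ifs at hz' with hf
        · rw [Finset.mem_singleton] at hz'
          subst hz'
          simp only [Finset.mem_filter, Finset.mem_product] at hz
          exact has hz.1.1
        · simp at hz'

theorem numRuns_sort_eq_sum {α β : Type*} [LinearOrder α] [Fintype α] [DecidableEq β] (f : α → β)
    (S : Finset α) :
    (numRuns ((S.sort (· ≤ ·)).map f) : ℝ)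
      = ∑ t, (if t ∈ S then 1 else 0) - ∑ t, ∑ t', if t < t' ∧ f t = f t' then
        (if t ∈ S ∧ t' ∈ S ∧ ∀ k ∈ S, ¬ (t < k ∧ k < t') then (1 : ℝ) else 0) else 0 := by
  have h := numRuns_sort_add_card f S
  rw [eq_sub_iff_add_eq, Finset.sum_boole, Finset.filter_mem_eq_inter, Finset.univ_inter, ← h]
  push_cast
  congr 1
  rw [← Finset.sum_product', Finset.univ_product_univ]
  simp_rw [← ite_and]
  rw [Finset.sum_boole]
  congr 2
  ext ⟨t, t'⟩
  simp only [Finset.mem_filter, Finset.mem_product, Finset.mem_univ, true_and]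
  tauto

theorem integral_numRuns_sort {α β : Type*} [LinearOrder α] [Fintype α] [DecidableEq β]
    (f : α → β) {Ω : Type*} [MeasurableSpace Ω] (P : Measure Ω) [IsProbabilityMeasure P] (p : ℝ)
    (T : Ω → Finset α) (hmeas : ∀ t, MeasurableSet {ω | t ∈ T ω})
    (hind : iIndepSet (fun t => {ω | t ∈ T ω}) P) (hp : ∀ t, P.real {ω | t ∈ T ω} = p) :
    Integrable (fun ω => (numRuns (((T ω).sort (· ≤ ·)).map f) : ℝ)) P ∧
    ∫ ω, (numRuns (((T ω).sort (· ≤ ·)).map f) : ℝ) ∂P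
      = p * Fintype.card α - ∑ t, ∑ t', if t < t' ∧ f t = f t' then
        p ^ 2 * (1 - p) ^ (Set.Ioo t t').ncard else 0 := by
  classical
  have hset : ∀ t t', {ω | t ∈ T ω ∧ t' ∈ T ω ∧ ∀ k ∈ T ω, ¬ (t < k ∧ k < t')}
      = ⋂ k ∈ insert t (insert t' (Finset.univ.filter fun k => t < k ∧ k < t')),
        if t < k ∧ k < t' then {ω | k ∈ T ω}ᶜ else {ω | k ∈ T ω} := by
    intro t t'
    ext ω
    simp only [Set.mem_ofPred_eq, Set.mem_iInter, Finset.mem_insert, Finset.mem_filter,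
      Finset.mem_univ, true_and, forall_eq_or_imp, lt_irrefl, false_and, and_false, if_false]
    refine and_congr Iff.rfl (and_congr Iff.rfl (forall_congr' fun k => ?_))
    by_cases hk : t < k ∧ k < t'
    · simp [hk]
    · simp [hk]
  have hm2 : ∀ t t', MeasurableSet {ω | t ∈ T ω ∧ t' ∈ T ω ∧ ∀ k ∈ T ω, ¬ (t < k ∧ k < t')} := by
    intro t t'
    rw [hset]
    refine Finset.measurableSet_biInter _ fun k _ => ?_
    split_ifs
    · exact (hmeas k).compl
    · exact hmeas k
  -- `t` and `t'` are present and everything between them is absent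
  have hprob : ∀ t t', t < t' →
      P.real {ω | t ∈ T ω ∧ t' ∈ T ω ∧ ∀ k ∈ T ω, ¬ (t < k ∧ k < t')}
        = p ^ 2 * (1 - p) ^ (Set.Ioo t t').ncard := by
    intro t t' htt
    have hI : Set.Ioo t t' = ↑(Finset.univ.filter fun k => t < k ∧ k < t') := by ext; simp
    rw [hI, Set.ncard_coe_finset]
    rw [hset, measureReal_def, ((iIndepSet_iff_iIndep _ _).1 hind).meas_biInter,
      ENNReal.toReal_prod, Finset.prod_insert, Finset.prod_insert]
    · simp only [lt_irrefl, false_and, and_false, if_false]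
      rw [← measureReal_def, ← measureReal_def, hp, hp, ← mul_assoc, ← pow_two,
        Finset.prod_eq_pow_card]
      intro k hk
      rw [if_pos (Finset.mem_filter.1 hk).2, ← measureReal_def, probReal_compl_eq_one_sub (hmeas k),
        hp]
    · simp
    · simp [htt.ne]
    · intro k _
      have : MeasurableSet[MeasurableSpace.generateFrom {{ω | k ∈ T ω}}] {ω | k ∈ T ω} :=
        MeasurableSpace.measurableSet_generateFrom (Set.mem_singleton _)
      split_ifs
      · exact this.compl
      · exact this
  have e1 : ∀ t, (fun ω => if t ∈ T ω then (1 : ℝ) else 0)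
      = {ω | t ∈ T ω}.indicator 1 := by
    intro t; ext ω; simp [Set.indicator]
  have e2 : ∀ t t', (fun ω => if t ∈ T ω ∧ t' ∈ T ω ∧ ∀ k ∈ T ω, ¬ (t < k ∧ k < t')
        then (1 : ℝ) else 0)
      = {ω | t ∈ T ω ∧ t' ∈ T ω ∧ ∀ k ∈ T ω, ¬ (t < k ∧ k < t')}.indicator 1 := by
    intro t t'; ext ω; simp only [Set.indicator, Set.mem_ofPred_eq, Pi.one_apply]
  have i1 : ∀ t, Integrable (fun ω => if t ∈ T ω then (1 : ℝ) else 0) P := by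
    intro t
    rw [e1]
    exact (integrable_const (1 : ℝ)).indicator (hmeas t)
  have i2 : ∀ t t', Integrable (fun ω => if t < t' ∧ f t = f t' then
      (if t ∈ T ω ∧ t' ∈ T ω ∧ ∀ k ∈ T ω, ¬ (t < k ∧ k < t') then (1 : ℝ) else 0) else 0) P := by
    intro t t'
    split_ifs
    · rw [e2]
      exact (integrable_const (1 : ℝ)).indicator (hm2 t t')
    · exact integrable_zero _ _ _
  have j1 : Integrable (fun ω => ∑ t, (if t ∈ T ω then (1 : ℝ) else 0)) P :=
    integrable_finsetSum _ fun t _ => i1 t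
  have j2 : Integrable (fun ω => ∑ t, ∑ t', if t < t' ∧ f t = f t' then
      (if t ∈ T ω ∧ t' ∈ T ω ∧ ∀ k ∈ T ω, ¬ (t < k ∧ k < t') then (1 : ℝ) else 0) else 0) P :=
    integrable_finsetSum _ fun t _ => integrable_finsetSum _ fun t' _ => i2 t t'
  simp_rw [numRuns_sort_eq_sum]
  refine ⟨j1.sub j2, ?_⟩
  rw [integral_sub j1 j2, integral_finsetSum _ fun t _ => i1 t,
    integral_finsetSum _ fun t _ => integrable_finsetSum _ fun t' _ => i2 t t']
  congr 1
  · rw [Finset.sum_congr rfl (g := fun _ => p)]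
    · rw [Finset.sum_const, Finset.card_univ, nsmul_eq_mul, mul_comm]
    · intro t _
      rw [e1, integral_indicator_one (hmeas t), hp]
  · refine Finset.sum_congr rfl fun t _ => ?_
    rw [integral_finsetSum _ fun t' _ => i2 t t']
    refine Finset.sum_congr rfl fun t' _ => ?_
    split_ifs with h
    · rw [e2, integral_indicator_one (hm2 t t'), hprob t t' h.1]
    · simp

/-! ### The lexicographic order on rows -/

/-- The number of rows that are lexicographically smaller than a given one, that is, the row read as
a number in mixed radix with the column `0` as its leading digit. -/
def rowIndex : {c : ℕ} → {N : Fin c → ℕ} → Row N → ℕ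
  | 0, _, _ => 0
  | c + 1, N, t => t 0 * ∏ j : Fin c, N j.succ
      + rowIndex (N := fun j : Fin c => N j.succ) (fun j => t j.succ)

theorem rowIndex_lt {c : ℕ} {N : Fin c → ℕ} (t : Row N) : rowIndex t < ∏ k, N k := by
  induction c with
  | zero => simp [rowIndex]
  | succ c ih =>
    rw [rowIndex, Fin.prod_univ_succ]
    have h1 := ih (N := fun j : Fin c => N j.succ) (fun j => t j.succ)
    have h2 : ((t 0 : ℕ) + 1) * ∏ j : Fin c, N j.succ ≤ N 0 * ∏ j : Fin c, N j.succ :=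
      Nat.mul_le_mul_right _ (t 0).isLt
    rw [Nat.succ_mul] at h2
    omega

theorem rowIndex_lt_rowIndex {c : ℕ} {N : Fin c → ℕ} {t t' : Row N} (h : toLex t < toLex t') :
    rowIndex t < rowIndex t' := by
  obtain ⟨i, hi, hlt⟩ := h
  simp only at hi hlt
  induction c with
  | zero => exact i.elim0
  | succ c ih =>
    rw [rowIndex, rowIndex]
    have h1 := rowIndex_lt (N := fun j : Fin c => N j.succ) (fun j => t j.succ)
    cases i using Fin.cases with
    | zero =>
      have h2 : ((t 0 : ℕ) + 1) * ∏ j : Fin c, N j.succ ≤ t' 0 * ∏ j : Fin c, N j.succ :=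
        Nat.mul_le_mul_right _ hlt
      rw [Nat.succ_mul] at h2
      omega
    | succ i =>
      have h0 : t 0 = t' 0 := hi 0 (Fin.succ_pos i)
      have := ih (N := fun j : Fin c => N j.succ) (t := fun j => t j.succ)
        (t' := fun j => t' j.succ) i (fun j hj => hi j.succ (Fin.succ_lt_succ_iff.2 hj)) hlt
      rw [h0]
      omega

theorem rowIndex_strictMono {c : ℕ} (N : Fin c → ℕ) :
    StrictMono (fun t : Lex (Row N) => rowIndex (ofLex t)) :=
  fun _ _ h => rowIndex_lt_rowIndex h

theorem rowIndex_div_mod {c : ℕ} {N : Fin c → ℕ} (t : Row N) (k : Fin c) :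
    rowIndex t / (∏ j with k < j, N j) % N k = t k := by
  induction c with
  | zero => exact k.elim0
  | succ c ih =>
    have h1 := rowIndex_lt (N := fun j : Fin c => N j.succ) (fun j => t j.succ)
    rw [rowIndex, Finset.prod_filter, Fin.prod_univ_succ]
    cases k using Fin.cases with
    | zero =>
      simp only [lt_irrefl, if_false, one_mul, Fin.succ_pos, if_true]
      rw [mul_comm, Nat.mul_add_div (by omega), Nat.div_eq_of_lt h1, add_zero,
        Nat.mod_eq_of_lt (t 0).isLt]
    | succ k =>
      simp only [Fin.not_lt_zero, if_false, one_mul, Fin.succ_lt_succ_iff]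
      have := ih (N := fun j : Fin c => N j.succ) (fun j => t j.succ) k
      rw [Finset.prod_filter] at this
      rw [← this]
      have hd : (∏ j : Fin c, if k < j then N j.succ else 1) * N k.succ
          ∣ ∏ j : Fin c, N j.succ := by
        rw [← Finset.prod_filter, mul_comm, ← Finset.prod_insert (s := Finset.univ.filter (k < ·))
          (f := fun j : Fin c => N j.succ) (by simp)]
        exact Finset.prod_dvd_prod_of_subset _ _ _ (Finset.subset_univ _)
      obtain ⟨m, hm⟩ := hd
      have hpos : 0 < ∏ j : Fin c, if k < j then N j.succ else 1 := by
        rcases Nat.eq_zero_or_pos (∏ j : Fin c, if k < j then N j.succ else 1) with h0 | h0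
        · rw [h0] at hm
          simp only [zero_mul] at hm
          omega
        · exact h0
      rw [hm, show (t 0 : ℕ) * ((∏ j : Fin c, if k < j then N j.succ else 1) * N k.succ * m)
        = (∏ j : Fin c, if k < j then N j.succ else 1) * (N k.succ * (t 0 * m)) by ring,
        Nat.mul_add_div hpos, Nat.mul_add_mod]

theorem image_rowIndex {c : ℕ} (N : Fin c → ℕ) :
    Finset.univ.image (fun t : Lex (Row N) => rowIndex (ofLex t)) = Finset.range (∏ k, N k) := by
  apply Finset.eq_of_subset_of_card_le
  · intro i hi
    obtain ⟨t, -, rfl⟩ := Finset.mem_image.1 hi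
    exact Finset.mem_range.2 (rowIndex_lt _)
  · rw [Finset.card_image_of_injective _ (rowIndex_strictMono N).injective, Finset.card_range,
      Finset.card_univ, Fintype.card_lex, Fintype.card_pi]
    simp

theorem sum_rowIndex {c : ℕ} (N : Fin c → ℕ) (g : ℕ → ℝ) :
    ∑ t : Lex (Row N), g (rowIndex (ofLex t)) = ∑ i ∈ Finset.range (∏ k, N k), g i := by
  rw [← image_rowIndex, Finset.sum_image fun _ _ _ _ h => (rowIndex_strictMono N).injective h]

theorem ncard_Ioo_lex {c : ℕ} {N : Fin c → ℕ} (t t' : Lex (Row N)) :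
    (Set.Ioo t t').ncard = rowIndex (ofLex t') - rowIndex (ofLex t) - 1 := by
  rw [← Nat.card_Ioo, ← Set.ncard_coe_finset, Finset.coe_Ioo,
    ← Set.ncard_image_of_injective _ (rowIndex_strictMono N).injective]
  congr 1
  ext i
  simp only [Set.mem_image, Set.mem_Ioo]
  constructor
  · rintro ⟨k, ⟨h1, h2⟩, rfl⟩
    exact ⟨rowIndex_strictMono N h1, rowIndex_strictMono N h2⟩
  · rintro ⟨h1, h2⟩
    have : i ∈ Finset.univ.image (fun t : Lex (Row N) => rowIndex (ofLex t)) := by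
      rw [image_rowIndex, Finset.mem_range]
      exact h2.trans (rowIndex_lt _)
    obtain ⟨k, -, rfl⟩ := Finset.mem_image.1 this
    exact ⟨k, ⟨(rowIndex_strictMono N).lt_iff_lt.1 h1, (rowIndex_strictMono N).lt_iff_lt.1 h2⟩, rfl⟩

theorem prod_split {c : ℕ} (N : Fin c → ℕ) (k : Fin c) :
    ∏ j, N j = (∏ j with j < k, N j) * N k * ∏ j with k < j, N j := by
  have : N k = ∏ j, if j = k then N j else 1 := by simp
  rw [this, Finset.prod_filter, Finset.prod_filter, ← Finset.prod_mul_distrib,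
    ← Finset.prod_mul_distrib]
  refine Finset.prod_congr rfl fun j _ => ?_
  rcases lt_trichotomy j k with h | rfl | h
  · simp [h, h.ne, h.not_gt]
  · simp
  · simp [h, h.ne', h.not_gt]

/-! ### The expected number of runs of a table -/

theorem integral_column {c : ℕ} (N : Fin c → ℕ) {Ω : Type*} [MeasurableSpace Ω] (P : Measure Ω)
    [IsProbabilityMeasure P] (p : ℝ) (T : Ω → Finset (Lex (Row N)))
    (hmeas : ∀ t, MeasurableSet {ω | t ∈ T ω})
    (hind : iIndepSet (fun t => {ω | t ∈ T ω}) P) (hp : ∀ t, P.real {ω | t ∈ T ω} = p)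
    (k : Fin c) :
    ∫ ω, (numRuns (((T ω).sort (· ≤ ·)).map fun t : Lex (Row _) => ofLex t k) : ℝ) ∂P
      = expectedColumnRuns (∏ j with j < k, N j) (N k) ((1 - p) ^ ∏ j with k < j, N j) := by
  rw [(integral_numRuns_sort (fun t : Lex (Row N) => ofLex t k) P p T hmeas hind hp).2]
  have hcard : Fintype.card (Lex (Row N)) = ∏ j, N j := by
    rw [Fintype.card_lex, Fintype.card_pi]; simp
  set M := ∏ j with j < k, N j
  set ρ := ∏ j with k < j, N j
  have hL : ∏ j, N j = M * N k * ρ := prod_split N k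
  have key := sum_equal_digit (M := M) (n := N k) (ρ := ρ) (1 - p)
  rw [sub_sub_cancel] at key
  trans p * Fintype.card (Lex (Row N)) - p ^ 2 * ∑ i ∈ Finset.range (M * N k * ρ),
      ∑ j ∈ Finset.range (M * N k * ρ),
        (if i < j ∧ i / ρ % N k = j / ρ % N k then (1 - p) ^ (j - i - 1) else 0)
  · congr 1
    rw [← hL, ← sum_rowIndex N, Finset.mul_sum]
    refine Finset.sum_congr rfl fun t _ => ?_
    rw [← sum_rowIndex N, Finset.mul_sum]
    refine Finset.sum_congr rfl fun t' _ => ?_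
    rw [ncard_Ioo_lex, rowIndex_div_mod, rowIndex_div_mod, mul_ite, mul_zero]
    exact if_congr (and_congr (rowIndex_strictMono N).lt_iff_lt.symm Fin.val_inj.symm) rfl rfl
  · rw [key, hcard, hL, expectedColumnRuns]
    push_cast
    ring

/-- Rearranging the columns of a uniformly distributed table yields a uniformly distributed table,
so the expected number of runs depends on the order only through the sequence of
cardinalities. -/
theorem expectedRuns_eq_sum {c : ℕ} (N : Fin c → ℕ)
    {Ω : Type*} [MeasurableSpace Ω] (P : Measure Ω) [IsProbabilityMeasure P]
    (p : ℝ) (T : Ω → Finset (Row N)) (hT : IsUniformlyDistributed P p T)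
    (σ : Equiv.Perm (Fin c)) :
    expectedRuns P T σ = ∑ k, expectedColumnRuns (∏ j with j < k, N (σ j)) (N (σ k))
      ((1 - p) ^ ∏ j with k < j, N (σ j)) := by
  set S : Ω → Finset (Lex (Row fun k => N (σ k))) :=
    fun ω => (reorderColumns σ (T ω)).map toLex.toEmbedding with hS
  let e : Lex (Row fun k => N (σ k)) ≃ Row N :=
    ofLex.trans (Equiv.piCongrLeft (fun k => Fin (N k)) σ)
  have hmem : ∀ u, {ω | u ∈ S ω} = {ω | e u ∈ T ω} := by
    intro u
    ext ω
    have he : ∀ t : Row N, (fun k => t (σ k)) = ofLex u ↔ t = e u := fun t =>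
      (Equiv.symm_apply_eq (Equiv.piCongrLeft (fun k => Fin (N k)) σ) (x := t) (y := ofLex u))
    simp only [hS, reorderColumns, Set.mem_ofPred_eq, Finset.mem_map_equiv, toLex_symm_eq,
      Finset.mem_image, he, exists_eq_right]
  have hmeas : ∀ u, MeasurableSet {ω | u ∈ S ω} := fun u => by
    rw [hmem]; exact hT.measurableSet_mem _
  have hind : iIndepSet (fun u => {ω | u ∈ S ω}) P := by
    simp_rw [hmem]
    exact hT.indep.precomp e.injective
  have hp : ∀ u, P.real {ω | u ∈ S ω} = p := fun u => by
    rw [hmem]; exact hT.prob_mem _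
  have hrun : ∀ ω, (runCount (lexSort (reorderColumns σ (T ω))) : ℝ)
      = ∑ k, (numRuns (((S ω).sort (· ≤ ·)).map fun t : Lex (Row _) => ofLex t k) : ℝ) := by
    intro ω
    simp only [runCount, lexSort, List.map_map]
    push_cast
    rfl
  rw [expectedRuns]
  simp_rw [hrun]
  rw [integral_finsetSum]
  · exact Finset.sum_congr rfl fun k _ => integral_column _ P p S hmeas hind hp k
  · exact fun k _ => (integral_numRuns_sort _ P p S hmeas hind hp).1

/-! ### Sorting the columns -/

/-- The sum of the main terms `M * columnCost n (q ^ ρ)` over the columns, for columns whose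
cardinalities are listed in order. -/
noncomputable def orderCost (q : ℝ) : List ℕ → ℝ
  | [] => 0
  | a :: l => columnCost a (q ^ l.prod) + a * orderCost q l

theorem sum_columnCost {c : ℕ} (N : Fin c → ℕ) (q : ℝ) :
    ∑ k, ((∏ j with j < k, N j : ℕ) : ℝ) * columnCost (N k) (q ^ ∏ j with k < j, N j)
      = orderCost q (List.ofFn N) := by
  induction c with
  | zero => simp [orderCost]
  | succ c ih =>
    rw [Fin.sum_univ_succ, List.ofFn_succ, orderCost, ← ih, List.prod_ofFn, Finset.mul_sum]
    simp only [Finset.prod_filter, Fin.prod_univ_succ, Fin.succ_lt_succ_iff, Fin.succ_pos,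
      Fin.not_lt_zero, if_false, if_true, one_mul, Finset.prod_const_one, lt_irrefl]
    congr 1
    · simp
    · refine Finset.sum_congr rfl fun k _ => ?_
      push_cast
      ring

theorem orderCost_orderedInsert_le {q : ℝ} (hq0 : 0 ≤ q) (hq1 : q ≤ 1) {a : ℕ}
    (l : List ℕ) (hl : ∀ b ∈ l, 2 ≤ b) :
    orderCost q (l.orderedInsert (· ≤ ·) a) ≤ orderCost q (a :: l) := by
  induction l with
  | nil => exact le_rfl
  | cons b l ih =>
    rw [List.orderedInsert_cons]
    split_ifs with hab
    · exact le_rfl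
    · have hb := hl b List.mem_cons_self
      -- exchange `a` and `b`, and then insert `a` into the tail
      have h1 := ih fun x hx => hl x (List.mem_cons_of_mem b hx)
      have h2 := columnCost_swap hb (le_of_not_ge hab) (pow_nonneg hq0 l.prod)
        (pow_le_one₀ hq0 hq1 : q ^ l.prod ≤ 1)
      have h3 := mul_le_mul_of_nonneg_left h1 (Nat.cast_nonneg (α := ℝ) b)
      have hperm := (List.perm_orderedInsert (· ≤ ·) a l).prod_eq
      simp only [orderCost, hperm, List.prod_cons] at h3 ⊢
      rw [← pow_mul, ← pow_mul, mul_comm l.prod a, mul_comm l.prod b] at h2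
      linarith

theorem orderCost_insertionSort_le {q : ℝ} (hq0 : 0 ≤ q) (hq1 : q ≤ 1) (l : List ℕ)
    (hl : ∀ b ∈ l, 2 ≤ b) : orderCost q (l.insertionSort (· ≤ ·)) ≤ orderCost q l := by
  induction l with
  | nil => exact le_rfl
  | cons a l ih =>
    have hperm := List.perm_insertionSort (· ≤ ·) l
    have h1 := ih fun x hx => hl x (List.mem_cons_of_mem a hx)
    refine (orderCost_orderedInsert_le hq0 hq1 _
      fun x hx => hl x (List.mem_cons_of_mem a (hperm.mem_iff.1 hx))).trans ?_
    rw [orderCost, orderCost, hperm.prod_eq]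
    gcongr

theorem orderCost_ofFn_le {c : ℕ} {N : Fin c → ℕ} (hN : ∀ k, 2 ≤ N k) (hmono : Monotone N)
    {q : ℝ} (hq0 : 0 ≤ q) (hq1 : q ≤ 1) (σ : Equiv.Perm (Fin c)) :
    orderCost q (List.ofFn N) ≤ orderCost q (List.ofFn fun k => N (σ k)) := by
  have hperm : (List.ofFn fun k => N (σ k)).Perm (List.ofFn N) := Equiv.Perm.ofFn_comp_perm σ N
  have : List.ofFn N = (List.ofFn fun k => N (σ k)).insertionSort (· ≤ ·) := by
    refine List.Perm.eq_of_pairwise' (r := (· ≤ ·)) ?_ ?_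
      (hperm.symm.trans (List.perm_insertionSort (· ≤ ·) _).symm)
    · exact List.pairwise_ofFn.2 fun i j hij => hmono hij.le
    · exact List.pairwise_insertionSort _ _
  rw [this]
  refine orderCost_insertionSort_le hq0 hq1 _ fun b hb => ?_
  obtain ⟨k, rfl⟩ := (List.mem_ofFn' _ _).1 hb
  exact hN _

theorem mainTheorem4 {c : ℕ} (N : Fin c → ℕ) (hN_ge : ∀ k, 2 ≤ N k) (hN_mono : Monotone N)
    (hN_le : ∀ k, N k ≤ 30)
    {Ω : Type*} [MeasurableSpace Ω] (P : Measure Ω) [IsProbabilityMeasure P]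
    (p : ℝ) (T : Ω → Finset (Row N)) (hT : IsUniformlyDistributed P p T)
    (σ : Equiv.Perm (Fin c)) :
    expectedRuns P T (Equiv.refl (Fin c)) ≤ expectedRuns P T σ + c := by
  -- the existence of a row forces `0 ≤ p ≤ 1`
  let t₀ : Row N := fun k => ⟨0, by have := hN_ge k; omega⟩
  have hp0 : 0 ≤ p := hT.prob_mem t₀ ▸ measureReal_nonneg
  have hp1 : p ≤ 1 := hT.prob_mem t₀ ▸ measureReal_le_one
  have hq0 : 0 ≤ 1 - p := by linarith
  have hq1 : 1 - p ≤ 1 := by linarith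
  have bound := fun (τ : Equiv.Perm (Fin c)) (k : Fin c) =>
    expectedColumnRuns_bounds (∏ j with j < k, N (τ j)) (hN_ge (τ k))
      (pow_nonneg hq0 (∏ j with k < j, N (τ j))) (pow_le_one₀ hq0 hq1)
  calc expectedRuns P T (Equiv.refl (Fin c))
      ≤ orderCost (1 - p) (List.ofFn N) + c := by
        rw [expectedRuns_eq_sum N P p T hT, ← sum_columnCost]
        refine (Finset.sum_le_sum fun k _ => (bound (Equiv.refl _) k).2).trans ?_
        simp [Finset.sum_add_distrib]
    _ ≤ orderCost (1 - p) (List.ofFn fun k => N (σ k)) + c := by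
        gcongr
        exact orderCost_ofFn_le hN_ge hN_mono hq0 hq1 σ
    _ ≤ expectedRuns P T σ + c := by
        rw [expectedRuns_eq_sum N P p T hT, ← sum_columnCost]
        gcongr with k
        exact (bound σ k).1
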